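/- Consider first-order constructive (intuitionistic) natural deduction without built-in equality, with the usual introduction and elimination rules for $\Rightarrow,\wedge,\vee,\forall,\exists$ and the rule that everything follows from $\bot$. A sequent $\Gamma\vdash B$ consists of a finite context $\Gamma$ of formulas and a formula $B$; free variables are allowed in both. Let $n\ge 0$, let $\overline{x}=x_1,\dots,x_n$ and $y$ be distinct variables, and let $A$ be a formula whose free variables are among $x_1,\dots,x_n,y$. Write $\forall\overline{x}\,C$ for $\forall x_1\cdots\forall x_n\,C$, write $f(\overline{x})$ for the term $f(x_1,\dots,x_n)$, and write $(t/y)A$ for the capture-avoiding substitution of the term $t$ for $y$ in $A$. **Theorem (Skolem theorem for constructive logic).** 1. Let $f$ be a function symbol of arity $n$ that occurs neither in $A$, nor in the formulas of the finite context $\Gamma$, nor in the formula $B$. If the sequents $\Gamma\vdash\forall\overline{x}\,\exists y\,A$ and $\Gamma,\ \forall\overline{x}\,(f(\overline{x})/y)A\vdash B$ are provable, then the sequent $\Gamma\vdash B$ is provable. 2. Hence adding the Skolem axiom gives a conservative extension. Let $\mathcal{L}$ be a language, $T$ a (finite or infinite) set of formulas of $\mathcal{L}$, $A$ a formula of $\mathcal{L}$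 as above, and let $\mathcal{L}'$ be $\mathcal{L}$ extended by a new function symbol $f$ of arity $n$. A formula is a theorem of a set of formulas if it is provable from finitely many of them, by a proof in the language considered. If $\forall\overline{x}\,\exists y\,A$ is a theorem of $T$ in $\mathcal{L}$, then, for every formula $B$ of $\mathcal{L}$, $B$ is a theorem of $T\cup\{\forall\overline{x}\,(f(\overline{x})/y)A\}$ in $\mathcal{L}'$ if and only if $B$ is a theorem of $T$ in $\mathcal{L}$. -/

import Mathlib

open scoped FirstOrder

universe u v u' v'

namespace IntLogic

/-- Formulas of first-order constructive logic over a language `L`, without a built-in equality.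
Formulas are taken up to renaming of bound variables, by means of de Bruijn indices: the variables
of terms are natural numbers, a quantifier binds the index `0` of its body, and the index `k + 1`
of the body is the variable `k` outside. -/
inductive IFormula (L : FirstOrder.Language.{u, v}) : Type (max u v)
  | rel {k : ℕ} (R : L.Relations k) (ts : Fin k → L.Term ℕ) : IFormula L
  | bot : IFormula L
  | imp (A B : IFormula L) : IFormula L
  | and (A B : IFormula L) : IFormula L
  | or (A B : IFormula L) : IFormula L
  | all (A : IFormula L) : IFormula L
  | ex (A : IFormula L) : IFormula L

/-- The substitution `σ`, carried under one quantifier. -/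
def liftSubst {L : FirstOrder.Language.{u, v}} (σ : ℕ → L.Term ℕ) : ℕ → L.Term ℕ
  | 0 => FirstOrder.Language.Term.var 0
  | k + 1 => (σ k).relabel Nat.succ

/-- The substitution of `t` for the variable `0`, every variable `k + 1` becoming `k`. -/
def instSubst {L : FirstOrder.Language.{u, v}} (t : L.Term ℕ) : ℕ → L.Term ℕ
  | 0 => t
  | k + 1 => FirstOrder.Language.Term.var k

/-- `f` occurs in the term `t`. -/
def OccursInTerm {L : FirstOrder.Language.{u, v}} {n : ℕ} (f : L.Functions n) : L.Term ℕ → Prop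
  | FirstOrder.Language.Term.var _ => False
  | FirstOrder.Language.Term.func (l := k) g ts =>
      (⟨k, g⟩ : Σ m, L.Functions m) = ⟨n, f⟩ ∨ ∃ i, OccursInTerm f (ts i)

namespace IFormula

/-- Simultaneous capture-avoiding substitution of `σ k` for every free variable `k`. -/
def subst {L : FirstOrder.Language.{u, v}} : IFormula L → (ℕ → L.Term ℕ) → IFormula L
  | rel R ts, σ => rel R (fun i => (ts i).subst σ)
  | bot, _ => bot
  | imp A B, σ => imp (A.subst σ) (B.subst σ)
  | and A B, σ => and (A.subst σ) (B.subst σ)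
  | or A B, σ => or (A.subst σ) (B.subst σ)
  | all A, σ => all (A.subst (liftSubst σ))
  | ex A, σ => ex (A.subst (liftSubst σ))

/-- The formula `A` read in a scope with one additional variable `0`, which is therefore fresh
for `A.shift`. -/
def shift {L : FirstOrder.Language.{u, v}} (A : IFormula L) : IFormula L :=
  A.subst (fun k => FirstOrder.Language.Term.var (k + 1))

/-- `A.inst t` is `(t/x)A`, where `x` is the variable `0` of `A`; that variable disappears, and the
variable `k + 1` of `A` becomes `k`. -/
def inst {L : FirstOrder.Language.{u, v}} (A : IFormula L) (t : L.Term ℕ) : IFormula L :=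
  A.subst (instSubst t)

/-- The variable `k` occurs free in the formula. -/
def FreeIn {L : FirstOrder.Language.{u, v}} : IFormula L → ℕ → Prop
  | rel _ ts, k => ∃ i, k ∈ (ts i).varFinset
  | bot, _ => False
  | imp A B, k => A.FreeIn k ∨ B.FreeIn k
  | and A B, k => A.FreeIn k ∨ B.FreeIn k
  | or A B, k => A.FreeIn k ∨ B.FreeIn k
  | all A, k => A.FreeIn (k + 1)
  | ex A, k => A.FreeIn (k + 1)

/-- The function symbol `f` occurs in the formula. -/
def Occurs {L : FirstOrder.Language.{u, v}} {n : ℕ} (f : L.Functions n) : IFormula L → Prop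
  | rel _ ts => ∃ i, OccursInTerm f (ts i)
  | bot => False
  | imp A B => A.Occurs f ∨ B.Occurs f
  | and A B => A.Occurs f ∨ B.Occurs f
  | or A B => A.Occurs f ∨ B.Occurs f
  | all A => A.Occurs f
  | ex A => A.Occurs f

/-- The image of a formula under a morphism of languages. -/
def mapLang {L : FirstOrder.Language.{u, v}} {L' : FirstOrder.Language.{u', v'}} (φ : L →ᴸ L') :
    IFormula L → IFormula L'
  | rel R ts => rel (φ.onRelation R) (fun i => φ.onTerm (ts i))
  | bot => bot
  | imp A B => imp (A.mapLang φ) (B.mapLang φ)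
  | and A B => and (A.mapLang φ) (B.mapLang φ)
  | or A B => or (A.mapLang φ) (B.mapLang φ)
  | all A => all (A.mapLang φ)
  | ex A => ex (A.mapLang φ)

/-- `∀ x₁ … ∀ xₙ A`; in the body `A`, the variable `xᵢ` is the index `n - i`. -/
def allN {L : FirstOrder.Language.{u, v}} : ℕ → IFormula L → IFormula L
  | 0, A => A
  | n + 1, A => all (allN n A)

end IFormula

/-- The sequent `Γ ⊢ B` is provable in constructive natural deduction. In the quantifier rules the
eigenvariable is the index `0`, fresh for the shifted context and conclusion. -/
inductive Provable {L : FirstOrder.Language.{u, v}} : List (IFormula L) → IFormula L → Prop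
  | ax {Γ : List (IFormula L)} {A : IFormula L} : A ∈ Γ → Provable Γ A
  | botE {Γ : List (IFormula L)} {A : IFormula L} : Provable Γ IFormula.bot → Provable Γ A
  | impI {Γ : List (IFormula L)} {A B : IFormula L} :
      Provable (A :: Γ) B → Provable Γ (A.imp B)
  | impE {Γ : List (IFormula L)} {A B : IFormula L} :
      Provable Γ (A.imp B) → Provable Γ A → Provable Γ B
  | andI {Γ : List (IFormula L)} {A B : IFormula L} :
      Provable Γ A → Provable Γ B → Provable Γ (A.and B)
  | andE₁ {Γ : List (IFormula L)} {A B : IFormula L} : Provable Γ (A.and B) → Provable Γ A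
  | andE₂ {Γ : List (IFormula L)} {A B : IFormula L} : Provable Γ (A.and B) → Provable Γ B
  | orI₁ {Γ : List (IFormula L)} {A B : IFormula L} : Provable Γ A → Provable Γ (A.or B)
  | orI₂ {Γ : List (IFormula L)} {A B : IFormula L} : Provable Γ B → Provable Γ (A.or B)
  | orE {Γ : List (IFormula L)} {A B C : IFormula L} :
      Provable Γ (A.or B) → Provable (A :: Γ) C → Provable (B :: Γ) C → Provable Γ C
  | allI {Γ : List (IFormula L)} {A : IFormula L} :
      Provable (Γ.map IFormula.shift) A → Provable Γ A.all
  | allE {Γ : List (IFormula L)} {A : IFormula L} (t : L.Term ℕ) :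
      Provable Γ A.all → Provable Γ (A.inst t)
  | exI {Γ : List (IFormula L)} {A : IFormula L} (t : L.Term ℕ) :
      Provable Γ (A.inst t) → Provable Γ A.ex
  | exE {Γ : List (IFormula L)} {A C : IFormula L} :
      Provable Γ A.ex → Provable (A :: Γ.map IFormula.shift) C.shift → Provable Γ C

/-- `B` is a theorem of the (possibly infinite) theory `T`. -/
def TheoremOf {L : FirstOrder.Language.{u, v}} (T : Set (IFormula L)) (B : IFormula L) : Prop :=
  ∃ Γ : List (IFormula L), (∀ C ∈ Γ, C ∈ T) ∧ Provable Γ B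

/-- Along the inclusion of languages `φ`, the theory `T'` is a conservative extension of `T`. -/
def IsConservativeExtension {L : FirstOrder.Language.{u, v}} {L' : FirstOrder.Language.{u', v'}}
    (φ : L →ᴸ L') (T : Set (IFormula L)) (T' : Set (IFormula L')) : Prop :=
  ∀ B : IFormula L, TheoremOf T' (B.mapLang φ) ↔ TheoremOf T B

/-- `∀ x₁ … ∀ xₙ ∃ y A`. In `A`, the variable `y` is the index `0` and `xᵢ` is the index
`n + 1 - i`. -/
def forallExists {L : FirstOrder.Language.{u, v}} (n : ℕ) (A : IFormula L) : IFormula L :=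
  IFormula.allN n A.ex

/-- The term `f(x₁, …, xₙ)`, in the scope of the quantifiers `∀ x₁ … ∀ xₙ`. -/
def skolemTerm {L : FirstOrder.Language.{u, v}} {n : ℕ} (f : L.Functions n) : L.Term ℕ :=
  FirstOrder.Language.Term.func f (fun i => FirstOrder.Language.Term.var (i.rev : ℕ))

/-- The Skolem axiom `∀ x₁ … ∀ xₙ (f(x₁, …, xₙ)/y)A`. -/
def skolemAxiom {L : FirstOrder.Language.{u, v}} {n : ℕ} (f : L.Functions n) (A : IFormula L) :
    IFormula L :=
  IFormula.allN n (A.inst (skolemTerm f))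

/-- The only function symbol of `oneFunction n`. -/
inductive OneFunction (n : ℕ) : ℕ → Type
  | symb : OneFunction n n

/-- The language with a single function symbol, of arity `n`, and no relation symbols. -/
def oneFunction (n : ℕ) : FirstOrder.Language.{0, 0} := ⟨OneFunction n, fun _ => Empty⟩

/-- The language `L` with a new function symbol of arity `n`. -/
abbrev withFunction (L : FirstOrder.Language.{u, v}) (n : ℕ) : FirstOrder.Language.{u, v} :=
  L.sum (oneFunction n)

/-- The new function symbol of `withFunction L n`. -/
def newFunction (L : FirstOrder.Language.{u, v}) (n : ℕ) : (withFunction L n).Functions n :=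
  Sum.inr OneFunction.symb

/-- The inclusion of `L` in `withFunction L n`. -/
def inclusion (L : FirstOrder.Language.{u, v}) (n : ℕ) : L →ᴸ withFunction L n :=
  FirstOrder.Language.LHom.sumInl

end IntLogic

open IntLogic

/-!
The proof is a forcing argument over provability in the language `L` without the new symbol, in the
manner of Beth semantics. A condition (`World`) is a finite context of `L`-formulas together with a
partial function `val` giving Skolem values: if `val` assigns `e` to the tuple `us`, the context
proves `A(us, e)`. A condition is strengthened by enlarging both parts. A property of conditions is
*covered* (`Cover`) at `p` if every `L`-formula that all stronger conditions with the property prove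
is already proved at `p`, and likewise at every condition stronger than `p`. Atoms, disjunctions and
existential quantifiers are forced up to covers, so that intuitionistic logic is sound for forcing
(`forces_of_provable`). Quantifiers range over all terms of the extended language `L'`, and such a
term is read as a term of `L` by looking up the values of the Skolem symbol in `val` (`Eval`).

Three facts then give the theorem.

* Every term of `L'` is evaluated up to a cover (`World.cover_eval`). To give a missing value to
  `us`, add `A(us, c)` to the context for a fresh variable `c` and let `c` be the value; since the
  context proves `∃ y, A(us, y)`, a conclusion in which `c` does not occur was provable before.
  There is no congruence axiom to respect, because the logic has no equality.
* A formula without the Skolem symbol is forced exactly when its reading in `L` is provable from the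
  context (`forces_iff_provable`).
* The Skolem axiom is forced (`forces_skolemAxiom`).

So if `Γ` and the Skolem axiom prove `B`, then `B` is forced at the condition with context `Γ` and
no values, that is, `Γ` proves `B`. Both parts are cases of `provable_of_provable_skolemAxiom`, for
the identity of the language and for the inclusion of `L` in its extension by `f`.
-/

namespace IntLogic

open FirstOrder.Language (Term LHom)

/-! ### Substitution -/

section Substitution

variable {L : FirstOrder.Language.{u, v}} {L' : FirstOrder.Language.{u', v'}}

/-- The environment with value `a` at `0` and value `σ k` at `k + 1`. -/
def envCons {α : Type*} (a : α) (σ : ℕ → α) : ℕ → α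
  | 0 => a
  | k + 1 => σ k

/-- The environment `σ` extended by the values of `n` nested quantifiers, `as 0` being that of the
outermost one, which is the variable `n - 1`. -/
def envConsN {α : Type*} {n : ℕ} (as : Fin n → α) (σ : ℕ → α) (k : ℕ) : α :=
  if h : k < n then as (Fin.rev ⟨k, h⟩) else σ (k - n)

theorem envConsN_zero {α : Type*} (as : Fin 0 → α) (σ : ℕ → α) : envConsN as σ = σ := by
  funext k
  simp [envConsN]

theorem envConsN_succ {α : Type*} {n : ℕ} (as : Fin (n + 1) → α) (σ : ℕ → α) :
    envConsN as σ = envConsN (fun i => as i.succ) (envCons (as 0) σ) := by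
  funext k
  rcases lt_trichotomy k n with h | rfl | h
  · have h' : k < n + 1 := by omega
    simp only [envConsN, h, h', dif_pos]
    congr 1
    ext
    simp only [Fin.val_rev, Fin.val_succ]
    omega
  · simp only [envConsN, lt_irrefl, Nat.lt_succ_self, dif_pos, dif_neg, not_false_eq_true,
      Nat.sub_self, envCons]
    congr 1
    ext
    simp only [Fin.val_rev, Fin.val_zero]
    omega
  · have h₁ : ¬ k < n := by omega
    have h₂ : ¬ k < n + 1 := by omega
    obtain ⟨j, rfl⟩ : ∃ j, k = n + 1 + j := ⟨k - (n + 1), by omega⟩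
    have h₃ : n + 1 + j - n = j + 1 := by omega
    have h₄ : n + 1 + j - (n + 1) = j := by omega
    simp only [envConsN, h₁, h₂, dif_neg, not_false_eq_true, h₃, h₄, envCons]

theorem term_subst_subst (t : L.Term ℕ) (σ τ : ℕ → L.Term ℕ) :
    (t.subst σ).subst τ = t.subst (fun k => (σ k).subst τ) := by
  induction t with
  | var k => rfl
  | func g ts ih => simp only [Term.subst, ih]

theorem term_subst_var (t : L.Term ℕ) : t.subst Term.var = t := by
  induction t with
  | var k => rfl
  | func g ts ih => simp only [Term.subst, ih]

theorem term_relabel_eq_subst (t : L.Term ℕ) (ρ : ℕ → ℕ) :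
    t.relabel ρ = t.subst (fun k => Term.var (ρ k)) := by
  induction t with
  | var k => rfl
  | func g ts ih => simp only [Term.subst, Term.relabel, ih]

theorem instSubst_eq_envCons (t : L.Term ℕ) : instSubst t = envCons t Term.var := by
  funext k
  cases k <;> rfl

theorem liftSubst_var : liftSubst (Term.var : ℕ → L.Term ℕ) = Term.var := by
  funext k
  cases k <;> rfl

theorem liftSubst_subst_envCons (σ τ : ℕ → L.Term ℕ) (t : L.Term ℕ) :
    (fun k => (liftSubst σ k).subst (envCons t τ)) = envCons t (fun k => (σ k).subst τ) := by
  funext k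
  cases k with
  | zero => rfl
  | succ k =>
    simp only [liftSubst, term_relabel_eq_subst, term_subst_subst]
    rfl

theorem liftSubst_subst_liftSubst (σ τ : ℕ → L.Term ℕ) :
    (fun k => (liftSubst σ k).subst (liftSubst τ)) = liftSubst (fun k => (σ k).subst τ) := by
  funext k
  cases k with
  | zero => rfl
  | succ k =>
    simp only [liftSubst, term_relabel_eq_subst, term_subst_subst]
    congr 1
    funext j
    exact term_relabel_eq_subst _ _

theorem subst_subst (A : IFormula L) (σ τ : ℕ → L.Term ℕ) :
    (A.subst σ).subst τ = A.subst (fun k => (σ k).subst τ) := by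
  induction A generalizing σ τ with
  | rel R ts => simp only [IFormula.subst, term_subst_subst]
  | bot => rfl
  | imp A B ihA ihB => simp only [IFormula.subst, ihA, ihB]
  | and A B ihA ihB => simp only [IFormula.subst, ihA, ihB]
  | or A B ihA ihB => simp only [IFormula.subst, ihA, ihB]
  | all A ih => simp only [IFormula.subst, ih, liftSubst_subst_liftSubst]
  | ex A ih => simp only [IFormula.subst, ih, liftSubst_subst_liftSubst]

theorem subst_var (A : IFormula L) : A.subst Term.var = A := by
  induction A with
  | rel R ts => simp only [IFormula.subst, term_subst_var]
  | bot => rfl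
  | imp A B ihA ihB => simp only [IFormula.subst, ihA, ihB]
  | and A B ihA ihB => simp only [IFormula.subst, ihA, ihB]
  | or A B ihA ihB => simp only [IFormula.subst, ihA, ihB]
  | all A ih => simp only [IFormula.subst, liftSubst_var, ih]
  | ex A ih => simp only [IFormula.subst, liftSubst_var, ih]

theorem subst_liftSubst_inst (A : IFormula L) (σ : ℕ → L.Term ℕ) (t : L.Term ℕ) :
    (A.subst (liftSubst σ)).inst t = A.subst (envCons t σ) := by
  rw [IFormula.inst, subst_subst, instSubst_eq_envCons, liftSubst_subst_envCons]
  simp only [term_subst_var]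

theorem inst_subst (A : IFormula L) (σ : ℕ → L.Term ℕ) (t : L.Term ℕ) :
    (A.inst t).subst σ = (A.subst (liftSubst σ)).inst (t.subst σ) := by
  rw [subst_liftSubst_inst, IFormula.inst, subst_subst]
  congr 1
  funext k
  cases k <;> rfl

theorem shift_subst_liftSubst (A : IFormula L) (σ : ℕ → L.Term ℕ) :
    A.shift.subst (liftSubst σ) = (A.subst σ).shift := by
  rw [IFormula.shift, IFormula.shift, subst_subst, subst_subst]
  congr 1
  funext k
  exact term_relabel_eq_subst _ _

/-- Only finitely many variables occur in a term. -/
theorem exists_term_subst_congr (t : L.Term ℕ) :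
    ∃ m, ∀ σ τ : ℕ → L.Term ℕ, (∀ k < m, σ k = τ k) → t.subst σ = t.subst τ := by
  induction t with
  | var k => exact ⟨k + 1, fun σ τ h => h k (Nat.lt_succ_self k)⟩
  | func g ts ih =>
    choose m hm using ih
    refine ⟨Finset.univ.sup m, fun σ τ h => ?_⟩
    simp only [Term.subst]
    congr 1
    funext i
    exact hm i σ τ fun k hk => h k (hk.trans_le (Finset.le_sup (Finset.mem_univ i)))

theorem liftSubst_congr {m : ℕ} {σ τ : ℕ → L.Term ℕ} (h : ∀ k < m, σ k = τ k) :
    ∀ k < m, liftSubst σ k = liftSubst τ k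
  | 0, _ => rfl
  | k + 1, hk => by simp only [liftSubst, h k (Nat.lt_of_succ_lt hk)]

/-- Only finitely many variables occur free in a formula. -/
theorem exists_subst_congr (A : IFormula L) :
    ∃ m, ∀ σ τ : ℕ → L.Term ℕ, (∀ k < m, σ k = τ k) → A.subst σ = A.subst τ := by
  have two : ∀ {A B : IFormula L} {a b : ℕ},
      (∀ σ τ : ℕ → L.Term ℕ, (∀ k < a, σ k = τ k) → A.subst σ = A.subst τ) →
      (∀ σ τ : ℕ → L.Term ℕ, (∀ k < b, σ k = τ k) → B.subst σ = B.subst τ) →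
      ∀ σ τ : ℕ → L.Term ℕ, (∀ k < max a b, σ k = τ k) →
        A.subst σ = A.subst τ ∧ B.subst σ = B.subst τ := fun ha hb σ τ h =>
    ⟨ha σ τ fun k hk => h k (lt_max_of_lt_left hk), hb σ τ fun k hk => h k (lt_max_of_lt_right hk)⟩
  induction A with
  | rel R ts =>
    choose m hm using fun i => exists_term_subst_congr (ts i)
    refine ⟨Finset.univ.sup m, fun σ τ h => ?_⟩
    simp only [IFormula.subst]
    congr 1
    funext i
    exact hm i σ τ fun k hk => h k (hk.trans_le (Finset.le_sup (Finset.mem_univ i)))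
  | bot => exact ⟨0, fun _ _ _ => rfl⟩
  | imp A B ihA ihB =>
    obtain ⟨a, ha⟩ := ihA
    obtain ⟨b, hb⟩ := ihB
    refine ⟨max a b, fun σ τ h => ?_⟩
    simp only [IFormula.subst, two ha hb σ τ h]
  | and A B ihA ihB =>
    obtain ⟨a, ha⟩ := ihA
    obtain ⟨b, hb⟩ := ihB
    refine ⟨max a b, fun σ τ h => ?_⟩
    simp only [IFormula.subst, two ha hb σ τ h]
  | or A B ihA ihB =>
    obtain ⟨a, ha⟩ := ihA
    obtain ⟨b, hb⟩ := ihB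
    refine ⟨max a b, fun σ τ h => ?_⟩
    simp only [IFormula.subst, two ha hb σ τ h]
  | all A ih =>
    obtain ⟨m, hm⟩ := ih
    refine ⟨m, fun σ τ h => ?_⟩
    simp only [IFormula.subst, hm _ _ (liftSubst_congr h)]
  | ex A ih =>
    obtain ⟨m, hm⟩ := ih
    refine ⟨m, fun σ τ h => ?_⟩
    simp only [IFormula.subst, hm _ _ (liftSubst_congr h)]

theorem exists_subst_congr_list (Γ : List (IFormula L)) :
    ∃ m, ∀ A ∈ Γ, ∀ σ τ : ℕ → L.Term ℕ, (∀ k < m, σ k = τ k) → A.subst σ = A.subst τ := by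
  induction Γ with
  | nil => exact ⟨0, by simp⟩
  | cons B Γ ih =>
    obtain ⟨m, hm⟩ := ih
    obtain ⟨b, hb⟩ := exists_subst_congr B
    refine ⟨max b m, fun A hA σ τ h => ?_⟩
    rcases List.mem_cons.1 hA with rfl | hA
    · exact hb σ τ fun k hk => h k (lt_max_of_lt_left hk)
    · exact hm A hA σ τ fun k hk => h k (lt_max_of_lt_right hk)

theorem onTerm_subst (φ : L →ᴸ L') (t : L.Term ℕ) (σ : ℕ → L.Term ℕ) :
    φ.onTerm (t.subst σ) = (φ.onTerm t).subst (fun k => φ.onTerm (σ k)) := by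
  induction t with
  | var k => rfl
  | func g ts ih => simp only [Term.subst, LHom.onTerm, ih]

theorem onTerm_liftSubst (φ : L →ᴸ L') (σ : ℕ → L.Term ℕ) :
    (fun k => φ.onTerm (liftSubst σ k)) = liftSubst (fun k => φ.onTerm (σ k)) := by
  funext k
  cases k with
  | zero => rfl
  | succ k =>
    simp only [liftSubst, term_relabel_eq_subst, onTerm_subst]
    rfl

theorem mapLang_subst (φ : L →ᴸ L') (A : IFormula L) (σ : ℕ → L.Term ℕ) :
    (A.subst σ).mapLang φ = (A.mapLang φ).subst (fun k => φ.onTerm (σ k)) := by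
  induction A generalizing σ with
  | rel R ts => simp only [IFormula.subst, IFormula.mapLang, onTerm_subst]
  | bot => rfl
  | imp A B ihA ihB => simp only [IFormula.subst, IFormula.mapLang, ihA, ihB]
  | and A B ihA ihB => simp only [IFormula.subst, IFormula.mapLang, ihA, ihB]
  | or A B ihA ihB => simp only [IFormula.subst, IFormula.mapLang, ihA, ihB]
  | all A ih => simp only [IFormula.subst, IFormula.mapLang, ih, onTerm_liftSubst]
  | ex A ih => simp only [IFormula.subst, IFormula.mapLang, ih, onTerm_liftSubst]

theorem mapLang_shift (φ : L →ᴸ L') (A : IFormula L) :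
    A.shift.mapLang φ = (A.mapLang φ).shift :=
  mapLang_subst φ A _

theorem mapLang_inst (φ : L →ᴸ L') (A : IFormula L) (t : L.Term ℕ) :
    (A.inst t).mapLang φ = (A.mapLang φ).inst (φ.onTerm t) := by
  rw [IFormula.inst, mapLang_subst, IFormula.inst]
  congr 1
  funext k
  cases k <;> rfl

theorem mapLang_id (A : IFormula L) : A.mapLang (LHom.id L) = A := by
  induction A with
  | rel R ts =>
    simp only [IFormula.mapLang, LHom.id_onTerm, id]
    rfl
  | bot => rfl
  | imp A B ihA ihB => simp only [IFormula.mapLang, ihA, ihB]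
  | and A B ihA ihB => simp only [IFormula.mapLang, ihA, ihB]
  | or A B ihA ihB => simp only [IFormula.mapLang, ihA, ihB]
  | all A ih => simp only [IFormula.mapLang, ih]
  | ex A ih => simp only [IFormula.mapLang, ih]

end Substitution

/-! ### Structural properties of provability -/

namespace Provable

variable {L : FirstOrder.Language.{u, v}} {L' : FirstOrder.Language.{u', v'}}

theorem weaken {Γ Δ : List (IFormula L)} {A : IFormula L} (h : Provable Γ A) (hΓ : Γ ⊆ Δ) :
    Provable Δ A := by
  induction h generalizing Δ with
  | ax h => exact .ax (hΓ h)
  | botE _ ih => exact .botE (ih hΓ)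
  | impI _ ih => exact .impI (ih (List.cons_subset_cons _ hΓ))
  | impE _ _ ih₁ ih₂ => exact .impE (ih₁ hΓ) (ih₂ hΓ)
  | andI _ _ ih₁ ih₂ => exact .andI (ih₁ hΓ) (ih₂ hΓ)
  | andE₁ _ ih => exact .andE₁ (ih hΓ)
  | andE₂ _ ih => exact .andE₂ (ih hΓ)
  | orI₁ _ ih => exact .orI₁ (ih hΓ)
  | orI₂ _ ih => exact .orI₂ (ih hΓ)
  | orE _ _ _ ih ih₁ ih₂ =>
    exact .orE (ih hΓ) (ih₁ (List.cons_subset_cons _ hΓ)) (ih₂ (List.cons_subset_cons _ hΓ))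
  | allI _ ih => exact .allI (ih (List.map_subset _ hΓ))
  | allE t _ ih => exact .allE t (ih hΓ)
  | exI t _ ih => exact .exI t (ih hΓ)
  | exE _ _ ih₁ ih₂ => exact .exE (ih₁ hΓ) (ih₂ (List.cons_subset_cons _ (List.map_subset _ hΓ)))

theorem subst {Γ : List (IFormula L)} {A : IFormula L} (h : Provable Γ A) (σ : ℕ → L.Term ℕ) :
    Provable (Γ.map (·.subst σ)) (A.subst σ) := by
  have shift_map : ∀ (Γ : List (IFormula L)) (σ : ℕ → L.Term ℕ),
      (Γ.map IFormula.shift).map (·.subst (liftSubst σ)) =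
        (Γ.map (·.subst σ)).map IFormula.shift := fun Γ σ => by
    simp only [List.map_map]
    exact List.map_congr_left fun D _ => shift_subst_liftSubst D σ
  induction h generalizing σ with
  | ax h => exact .ax (List.mem_map_of_mem h)
  | botE _ ih => exact .botE (ih σ)
  | impI _ ih => exact .impI (ih σ)
  | impE _ _ ih₁ ih₂ => exact .impE (ih₁ σ) (ih₂ σ)
  | andI _ _ ih₁ ih₂ => exact .andI (ih₁ σ) (ih₂ σ)
  | andE₁ _ ih => exact .andE₁ (ih σ)
  | andE₂ _ ih => exact .andE₂ (ih σ)
  | orI₁ _ ih => exact .orI₁ (ih σ)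
  | orI₂ _ ih => exact .orI₂ (ih σ)
  | orE _ _ _ ih ih₁ ih₂ => exact .orE (ih σ) (ih₁ σ) (ih₂ σ)
  | allI _ ih =>
    have := ih (liftSubst σ)
    rw [shift_map] at this
    exact .allI this
  | allE t _ ih =>
    rw [inst_subst]
    exact .allE _ (ih σ)
  | exI t _ ih =>
    have := ih σ
    rw [inst_subst] at this
    exact .exI _ this
  | exE _ _ ih₁ ih₂ =>
    have := ih₂ (liftSubst σ)
    rw [List.map_cons, shift_map, shift_subst_liftSubst] at this
    exact .exE (ih₁ σ) this

theorem mapLang (φ : L →ᴸ L') {Γ : List (IFormula L)} {A : IFormula L} (h : Provable Γ A) :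
    Provable (Γ.map (·.mapLang φ)) (A.mapLang φ) := by
  have shift_map : ∀ Γ : List (IFormula L), (Γ.map IFormula.shift).map (·.mapLang φ) =
      (Γ.map (·.mapLang φ)).map IFormula.shift := fun Γ => by
    simp only [List.map_map]
    exact List.map_congr_left fun D _ => mapLang_shift φ D
  induction h with
  | ax h => exact .ax (List.mem_map_of_mem h)
  | botE _ ih => exact .botE ih
  | impI _ ih => exact .impI ih
  | impE _ _ ih₁ ih₂ => exact .impE ih₁ ih₂
  | andI _ _ ih₁ ih₂ => exact .andI ih₁ ih₂
  | andE₁ _ ih => exact .andE₁ ih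
  | andE₂ _ ih => exact .andE₂ ih
  | orI₁ _ ih => exact .orI₁ ih
  | orI₂ _ ih => exact .orI₂ ih
  | orE _ _ _ ih ih₁ ih₂ => exact .orE ih ih₁ ih₂
  | allI _ ih =>
    rw [shift_map] at ih
    exact .allI ih
  | allE t _ ih =>
    rw [mapLang_inst]
    exact .allE _ ih
  | exI t _ ih =>
    rw [mapLang_inst] at ih
    exact .exI _ ih
  | exE _ _ ih₁ ih₂ =>
    rw [List.map_cons, shift_map, mapLang_shift] at ih₂
    exact .exE ih₁ ih₂

/-- Elimination of `n` nested universal quantifiers at once. -/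
theorem allN_elim {Γ : List (IFormula L)} {n : ℕ} {A : IFormula L} {σ : ℕ → L.Term ℕ}
    (h : Provable Γ ((IFormula.allN n A).subst σ)) (ts : Fin n → L.Term ℕ) :
    Provable Γ (A.subst (envConsN ts σ)) := by
  induction n generalizing σ with
  | zero => rwa [envConsN_zero]
  | succ n ih =>
    rw [envConsN_succ]
    apply ih
    rw [← subst_liftSubst_inst]
    exact .allE _ h

/-- The substitution renaming the variable `c` to the eigenvariable `0` and shifting the others. -/
def eigenSubst (c : ℕ) : ℕ → L.Term ℕ :=
  fun k => if k = c then Term.var 0 else Term.var (k + 1)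

/-- Beyond the free variables of a context and of a formula, every variable can be renamed to an
eigenvariable. -/
theorem exists_fresh (Γ : List (IFormula L)) (A : IFormula L) :
    ∃ c, (∀ D ∈ Γ, D.subst (eigenSubst c) = D.shift) ∧
      (A.inst (Term.var c)).subst (eigenSubst c) = A := by
  obtain ⟨m, hm⟩ := exists_subst_congr_list (A :: Γ)
  have small : ∀ k < m, (eigenSubst m : ℕ → L.Term ℕ) k = Term.var (k + 1) := fun k hk =>
    if_neg hk.ne
  refine ⟨m, fun D hD => hm D (List.mem_cons_of_mem _ hD) _ _ small, ?_⟩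
  rw [IFormula.inst, subst_subst]
  refine (hm A List.mem_cons_self _ _ fun k hk => ?_).trans (subst_var A)
  cases k with
  | zero => exact if_pos rfl
  | succ k => exact small k (Nat.lt_of_succ_lt hk)

/-- Generalization over a fresh named variable. -/
theorem exists_allI (Γ : List (IFormula L)) (A : IFormula L) :
    ∃ c, Provable Γ (A.inst (Term.var c)) → Provable Γ A.all := by
  obtain ⟨c, hΓ, hA⟩ := exists_fresh Γ A
  refine ⟨c, fun h => .allI ?_⟩
  have := h.subst (eigenSubst c)
  rwa [hA, List.map_congr_left hΓ] at this

/-- Existential elimination with a fresh named variable. -/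
theorem exists_exE (Γ : List (IFormula L)) (A B : IFormula L) :
    ∃ c, Provable Γ A.ex → Provable (A.inst (Term.var c) :: Γ) B → Provable Γ B := by
  obtain ⟨c, hΓ, hA⟩ := exists_fresh (B :: Γ) A
  refine ⟨c, fun hex h => .exE hex ?_⟩
  have := h.subst (eigenSubst c)
  rwa [List.map_cons, hA, hΓ B List.mem_cons_self,
    List.map_congr_left fun D hD => hΓ D (List.mem_cons_of_mem _ hD)] at this

end Provable

/-! ### Conditions and covers -/

/-- A forcing condition: a context proving `∀ x₁ … ∀ xₙ ∃ y A`, and the graph of a partial function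
of Skolem values, correct for `A` according to the context. Free variables of `A` other than
`x₁, …, xₙ, y` are parameters and stand for themselves. -/
structure World (L : FirstOrder.Language.{u, v}) (n : ℕ) (A : IFormula L) where
  ctx : List (IFormula L)
  val : Set ((Fin n → L.Term ℕ) × L.Term ℕ)
  total : Provable ctx (forallExists n A)
  functional : ∀ us e e', (us, e) ∈ val → (us, e') ∈ val → e = e'
  sound : ∀ us e, (us, e) ∈ val → Provable ctx (A.subst (envCons e (envConsN us Term.var)))

namespace World

variable {L : FirstOrder.Language.{u, v}} {n : ℕ} {A : IFormula L}

/-- Stronger conditions are larger. -/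
instance : Preorder (World L n A) where
  le p q := p.ctx ⊆ q.ctx ∧ p.val ⊆ q.val
  le_refl _ := ⟨fun _ h => h, fun _ h => h⟩
  le_trans _ _ _ h h' := ⟨fun _ hx => h'.1 (h.1 hx), fun _ hx => h'.2 (h.2 hx)⟩

/-- The condition `p` with one more hypothesis. -/
def addHyp (p : World L n A) (D : IFormula L) : World L n A where
  ctx := D :: p.ctx
  val := p.val
  total := p.total.weaken (List.subset_cons_self _ _)
  functional := p.functional
  sound us e h := (p.sound us e h).weaken (List.subset_cons_self _ _)

theorem le_addHyp (p : World L n A) (D : IFormula L) : p ≤ p.addHyp D :=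
  ⟨List.subset_cons_self _ _, fun _ h => h⟩

/-- The condition `p` with the Skolem value `e` for the tuple `us`, and the hypothesis that this
value is correct. -/
def addValue (p : World L n A) (us : Fin n → L.Term ℕ) (e : L.Term ℕ)
    (h : ∀ e', (us, e') ∉ p.val) : World L n A where
  ctx := A.subst (envCons e (envConsN us Term.var)) :: p.ctx
  val := insert (us, e) p.val
  total := p.total.weaken (List.subset_cons_self _ _)
  functional := by
    rintro vs a b (ha | ha) (hb | hb)
    · exact (congrArg Prod.snd ha).trans (congrArg Prod.snd hb).symm
    · cases ha
      exact (h _ hb).elim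
    · cases hb
      exact (h _ ha).elim
    · exact p.functional vs a b ha hb
  sound := by
    rintro vs a (ha | ha)
    · cases ha
      exact .ax List.mem_cons_self
    · exact (p.sound vs a ha).weaken (List.subset_cons_self _ _)

theorem le_addValue (p : World L n A) (us : Fin n → L.Term ℕ) (e : L.Term ℕ)
    (h : ∀ e', (us, e') ∉ p.val) : p ≤ p.addValue us e h :=
  ⟨List.subset_cons_self _ _, Set.subset_insert _ _⟩

/-- The conditions with property `Q` cover `p`: hereditarily above `p`, a formula that is provable
wherever `Q` holds is provable. -/
def Cover (Q : World L n A → Prop) (p : World L n A) : Prop :=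
  ∀ (Z : IFormula L) (q : World L n A), p ≤ q →
    (∀ r, q ≤ r → Q r → Provable r.ctx Z) → Provable q.ctx Z

theorem Cover.mono {Q : World L n A → Prop} {p q : World L n A} (h : Cover Q p) (hpq : p ≤ q) :
    Cover Q q :=
  fun Z r hr => h Z r (hpq.trans hr)

theorem Cover.of_forall {Q : World L n A → Prop} {p : World L n A} (h : ∀ q, p ≤ q → Q q) :
    Cover Q p :=
  fun _ q hq hZ => hZ q le_rfl (h q hq)

theorem Cover.bind {Q Q' : World L n A → Prop} {p : World L n A} (h : Cover Q p)
    (h' : ∀ q, p ≤ q → Q q → Cover Q' q) : Cover Q' p :=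
  fun Z q hq hZ => h Z q hq fun r hr hQ =>
    h' r (hq.trans hr) hQ Z r le_rfl fun s hs => hZ s (hr.trans hs)

theorem Cover.map {Q Q' : World L n A → Prop} {p : World L n A} (h : Cover Q p)
    (h' : ∀ q, p ≤ q → Q q → Q' q) : Cover Q' p :=
  fun Z q hq hZ => h Z q hq fun r hr hQ => hZ r hr (h' r (hq.trans hr) hQ)

/-- Finitely many covers have a common refinement. -/
theorem Cover.finite_forall {k : ℕ} {Q : Fin k → World L n A → Prop} {p : World L n A}
    (hmono : ∀ i q r, q ≤ r → Q i q → Q i r) (h : ∀ i, Cover (Q i) p) :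
    Cover (fun q => ∀ i, Q i q) p := by
  induction k with
  | zero => exact Cover.of_forall fun _ _ i => i.elim0
  | succ k ih =>
    refine (ih (fun i => hmono i.succ) fun i => h i.succ).bind fun q hq hQ => ?_
    refine ((h 0).mono hq).map fun r hr h0 i => ?_
    exact Fin.cases h0 (fun i => hmono i.succ q r hr (hQ i)) i

end World

/-! ### Evaluation of terms -/

section Evaluation

variable {L : FirstOrder.Language.{u, v}} {L' : FirstOrder.Language.{u', v'}} {n : ℕ}

/-- The graph of the partial evaluation of terms of `L'` in terms of `L`: the Skolem symbol `f` is
looked up in the graph `V`, variables and the other symbols stand for themselves. -/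
def Eval (φ : L →ᴸ L') (f : L'.Functions n) (V : Set ((Fin n → L.Term ℕ) × L.Term ℕ)) :
    L'.Term ℕ → L.Term ℕ → Prop
  | Term.var k, s => s = Term.var k
  | Term.func (l := k) g ts, s => ∃ us : Fin k → L.Term ℕ, (∀ i, Eval φ f V (ts i) (us i)) ∧
      (((⟨k, g⟩ : Σ m, L'.Functions m) ≠ ⟨n, f⟩ ∧ ∃ h, φ.onFunction h = g ∧ s = Term.func h us) ∨
        ∃ vs, (vs, s) ∈ V ∧
          (⟨k, g, us⟩ : Σ m, L'.Functions m × (Fin m → L.Term ℕ)) = ⟨n, f, vs⟩)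

variable {φ : L →ᴸ L'} {f : L'.Functions n} {V W : Set ((Fin n → L.Term ℕ) × L.Term ℕ)}

theorem Eval.mono (hVW : V ⊆ W) {t : L'.Term ℕ} {s : L.Term ℕ} (h : Eval φ f V t s) :
    Eval φ f W t s := by
  induction t generalizing s with
  | var k => exact h
  | func g ts ih =>
    obtain ⟨us, hus, h⟩ := h
    refine ⟨us, fun i => ih i (hus i), h.imp_right ?_⟩
    rintro ⟨vs, hvs, h⟩
    exact ⟨vs, hVW hvs, h⟩

theorem Eval.unique (hφ : φ.Injective)
    (hV : ∀ us e e', (us, e) ∈ V → (us, e') ∈ V → e = e') {t : L'.Term ℕ} {s s' : L.Term ℕ}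
    (h : Eval φ f V t s) (h' : Eval φ f V t s') : s = s' := by
  induction t generalizing s s' with
  | var k => exact Eq.trans h (Eq.symm h')
  | @func k g ts ih =>
    obtain ⟨us, hus, h⟩ := h
    obtain ⟨us', hus', h'⟩ := h'
    obtain rfl : us = us' := funext fun i => ih i (hus i) (hus' i)
    have symb : ∀ {vs}, (⟨k, g, us⟩ : Σ m, L'.Functions m × (Fin m → L.Term ℕ)) = ⟨n, f, vs⟩ →
        (⟨k, g⟩ : Σ m, L'.Functions m) = ⟨n, f⟩ := fun h =>
      congrArg (fun x : Σ m, L'.Functions m × (Fin m → L.Term ℕ) =>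
        (⟨x.1, x.2.1⟩ : Σ m, L'.Functions m)) h
    rcases h with ⟨hg, a, ha, rfl⟩ | ⟨vs, hvs, h⟩ <;>
      rcases h' with ⟨hg', a', ha', rfl⟩ | ⟨vs', hvs', h'⟩
    · rw [hφ.onFunction (ha.trans ha'.symm)]
    · exact (hg (symb h')).elim
    · exact (hg' (symb h)).elim
    · obtain rfl : vs = vs' := by
        have := h.symm.trans h'
        simpa using this
      exact hV _ _ _ hvs hvs'

theorem eval_skolem_iff {ts : Fin n → L'.Term ℕ} {s : L.Term ℕ} :
    Eval φ f V (Term.func f ts) s ↔ ∃ us, (∀ i, Eval φ f V (ts i) (us i)) ∧ (us, s) ∈ V := by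
  constructor
  · rintro ⟨us, hus, ⟨h, -⟩ | ⟨vs, hvs, h⟩⟩
    · exact (h rfl).elim
    · obtain rfl : us = vs := by simpa using h
      exact ⟨us, hus, hvs⟩
  · rintro ⟨us, hus, h⟩
    exact ⟨us, hus, .inr ⟨us, h, rfl⟩⟩

/-- On terms without the Skolem symbol, evaluation is substitution. -/
theorem eval_onTerm_subst {σ : ℕ → L'.Term ℕ} {s : ℕ → L.Term ℕ}
    (hs : ∀ k, Eval φ f V (σ k) (s k)) {t : L.Term ℕ} (ht : ¬ OccursInTerm f (φ.onTerm t)) :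
    Eval φ f V ((φ.onTerm t).subst σ) (t.subst s) := by
  induction t with
  | var k => exact hs k
  | func g ts ih =>
    simp only [LHom.onTerm, OccursInTerm, not_or, not_exists] at ht
    exact ⟨_, fun i => ih i (ht.2 i), .inl ⟨ht.1, g, rfl, rfl⟩⟩

theorem eval_envCons {σ : ℕ → L'.Term ℕ} {s : ℕ → L.Term ℕ} {t : L'.Term ℕ} {a : L.Term ℕ}
    (ha : Eval φ f V t a) (hs : ∀ k, Eval φ f V (σ k) (s k)) :
    ∀ k, Eval φ f V (envCons t σ k) (envCons a s k)
  | 0 => ha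
  | k + 1 => hs k

theorem eval_envConsN {σ : ℕ → L'.Term ℕ} {s : ℕ → L.Term ℕ} {m : ℕ} {ts : Fin m → L'.Term ℕ}
    {us : Fin m → L.Term ℕ} (hus : ∀ i, Eval φ f V (ts i) (us i))
    (hs : ∀ k, Eval φ f V (σ k) (s k)) (k : ℕ) :
    Eval φ f V (envConsN ts σ k) (envConsN us s k) := by
  unfold envConsN
  split
  · exact hus _
  · exact hs _

/-- Every term has a value up to a cover. -/
theorem World.cover_eval {A : IFormula L}
    (hf : ∀ k (g : L'.Functions k), (⟨k, g⟩ : Σ m, L'.Functions m) ≠ ⟨n, f⟩ →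
      ∃ h, φ.onFunction h = g)
    (p : World L n A) (t : L'.Term ℕ) : p.Cover (fun q => ∃ s, Eval φ f q.val t s) := by
  induction t with
  | var k => exact Cover.of_forall fun _ _ => ⟨Term.var k, rfl⟩
  | @func k g ts ih =>
    have args := Cover.finite_forall (Q := fun i q => ∃ s, Eval φ f q.val (ts i) s)
      (fun i q r hqr => fun ⟨s, hs⟩ => ⟨s, hs.mono hqr.2⟩) ih
    refine args.bind fun q _ hq => ?_
    choose us hus using hq
    by_cases hg : (⟨k, g⟩ : Σ m, L'.Functions m) = ⟨n, f⟩
    · cases hg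
      by_cases hval : ∃ e, (us, e) ∈ q.val
      · obtain ⟨e, he⟩ := hval
        exact Cover.of_forall fun r hr =>
          ⟨e, eval_skolem_iff.2 ⟨us, fun i => (hus i).mono hr.2, hr.2 he⟩⟩
      · intro Z r hr hZ
        by_cases hval' : ∃ e, (us, e) ∈ r.val
        · obtain ⟨e, he⟩ := hval'
          exact hZ r le_rfl ⟨e, eval_skolem_iff.2 ⟨us, fun i => (hus i).mono hr.2, he⟩⟩
        -- The new value is a variable that is fresh for `r`, for `Z` and for `∃ y, A(us, y)`.
        · obtain ⟨c, hc⟩ := Provable.exists_exE r.ctx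
            (A.subst (liftSubst (envConsN us Term.var))) Z
          refine hc (Provable.allN_elim (by rw [subst_var]; exact r.total) us) ?_
          rw [subst_liftSubst_inst]
          have hle := r.le_addValue us (Term.var c) (not_exists.1 hval')
          exact hZ _ hle ⟨Term.var c, eval_skolem_iff.2
            ⟨us, fun i => (hus i).mono (hr.trans hle).2, Set.mem_insert _ _⟩⟩
    · obtain ⟨h, rfl⟩ := hf k g hg
      exact Cover.of_forall fun r hr =>
        ⟨Term.func h us, us, fun i => (hus i).mono hr.2, .inl ⟨hg, h, rfl, rfl⟩⟩

end Evaluation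

/-! ### Forcing -/

section Forcing

variable {L : FirstOrder.Language.{u, v}} {L' : FirstOrder.Language.{u', v'}} {n : ℕ}
  {A : IFormula L}

/-- The condition `p` forces a formula of `L'` under the assignment `σ`. The individuals are the
terms of `L'`, so that substitution in formulas is composition of assignments. -/
def Forces (φ : L →ᴸ L') (f : L'.Functions n) :
    World L n A → (ℕ → L'.Term ℕ) → IFormula L' → Prop
  | p, σ, IFormula.rel (k := k) R ts => p.Cover fun q => ∃ (S : L.Relations k) (us : _),
      φ.onRelation S = R ∧ (∀ i, Eval φ f q.val ((ts i).subst σ) (us i)) ∧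
        Provable q.ctx (IFormula.rel S us)
  | p, _, IFormula.bot => p.Cover fun _ => False
  | p, σ, IFormula.imp C D => ∀ q, p ≤ q → Forces φ f q σ C → Forces φ f q σ D
  | p, σ, IFormula.and C D => Forces φ f p σ C ∧ Forces φ f p σ D
  | p, σ, IFormula.or C D => p.Cover fun q => Forces φ f q σ C ∨ Forces φ f q σ D
  | p, σ, IFormula.all C => ∀ t, Forces φ f p (envCons t σ) C
  | p, σ, IFormula.ex C => p.Cover fun q => ∃ t, Forces φ f q (envCons t σ) C

variable {φ : L →ᴸ L'} {f : L'.Functions n}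

theorem Forces.mono {C : IFormula L'} {p q : World L n A} {σ : ℕ → L'.Term ℕ}
    (h : Forces φ f p σ C) (hpq : p ≤ q) : Forces φ f q σ C := by
  induction C generalizing σ with
  | rel R ts => exact World.Cover.mono h hpq
  | bot => exact World.Cover.mono h hpq
  | imp C D _ _ => exact fun r hr => h r (hpq.trans hr)
  | and C D ihC ihD => exact ⟨ihC h.1, ihD h.2⟩
  | or C D _ _ => exact World.Cover.mono h hpq
  | all C ih => exact fun t => ih (h t)
  | ex C _ => exact World.Cover.mono h hpq

/-- Forcing is local: it may be checked on a cover. -/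
theorem Forces.of_cover {C : IFormula L'} {p : World L n A} {σ : ℕ → L'.Term ℕ}
    (h : p.Cover fun q => Forces φ f q σ C) : Forces φ f p σ C := by
  induction C generalizing σ p with
  | rel R ts => exact h.bind fun _ _ h => h
  | bot => exact h.bind fun _ _ h => h
  | imp C D _ ihD =>
    exact fun q hq hC => ihD ((h.mono hq).map fun r hr h => h r le_rfl (hC.mono hr))
  | and C D ihC ihD => exact ⟨ihC (h.map fun _ _ h => h.1), ihD (h.map fun _ _ h => h.2)⟩
  | or C D _ _ => exact h.bind fun _ _ h => h
  | all C ih => exact fun t => ih (h.map fun _ _ h => h t)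
  | ex C _ => exact h.bind fun _ _ h => h

theorem Forces.of_cover_false {C : IFormula L'} {p : World L n A} {σ : ℕ → L'.Term ℕ}
    (h : p.Cover fun _ => False) : Forces φ f p σ C :=
  .of_cover (h.map fun _ _ h => h.elim)

theorem forces_subst {C : IFormula L'} {p : World L n A} {σ τ : ℕ → L'.Term ℕ} :
    Forces φ f p σ (C.subst τ) ↔ Forces φ f p (fun k => (τ k).subst σ) C := by
  induction C generalizing σ τ p with
  | rel R ts => simp only [IFormula.subst, Forces, term_subst_subst]
  | bot => rfl
  | imp C D ihC ihD => simp only [IFormula.subst, Forces, ihC, ihD]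
  | and C D ihC ihD => simp only [IFormula.subst, Forces, ihC, ihD]
  | or C D ihC ihD => simp only [IFormula.subst, Forces, ihC, ihD]
  | all C ih => simp only [IFormula.subst, Forces, ih, liftSubst_subst_envCons]
  | ex C ih => simp only [IFormula.subst, Forces, ih, liftSubst_subst_envCons]

theorem forces_shift {C : IFormula L'} {p : World L n A} {σ : ℕ → L'.Term ℕ} {t : L'.Term ℕ} :
    Forces φ f p (envCons t σ) C.shift ↔ Forces φ f p σ C :=
  forces_subst

theorem forces_inst {C : IFormula L'} {p : World L n A} {σ : ℕ → L'.Term ℕ} {t : L'.Term ℕ} :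
    Forces φ f p σ (C.inst t) ↔ Forces φ f p (envCons (t.subst σ) σ) C := by
  have : (fun k => (instSubst t k).subst σ) = envCons (t.subst σ) σ := by
    funext k
    cases k <;> rfl
  rw [IFormula.inst, forces_subst, this]

theorem forces_allN {C : IFormula L'} {m : ℕ} {p : World L n A} {σ : ℕ → L'.Term ℕ} :
    Forces φ f p σ (IFormula.allN m C) ↔ ∀ ts, Forces φ f p (envConsN (n := m) ts σ) C := by
  induction m generalizing σ with
  | zero => simp only [IFormula.allN, envConsN_zero, forall_const]
  | succ m ih =>
    simp only [IFormula.allN, Forces, ih, envConsN_succ]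
    exact ⟨fun h ts => h _ _, fun h t ts => h (Fin.cons t ts)⟩

/-- Soundness of intuitionistic logic for forcing. -/
theorem forces_of_provable {Γ : List (IFormula L')} {C : IFormula L'} (h : Provable Γ C)
    {p : World L n A} {σ : ℕ → L'.Term ℕ} (hΓ : ∀ D ∈ Γ, Forces φ f p σ D) :
    Forces φ f p σ C := by
  have cons : ∀ {Γ : List (IFormula L')} {D : IFormula L'} {p q : World L n A}
      {σ : ℕ → L'.Term ℕ}, (∀ D ∈ Γ, Forces φ f p σ D) → p ≤ q → Forces φ f q σ D →
      ∀ E ∈ D :: Γ, Forces φ f q σ E := fun hΓ hpq hD =>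
    List.forall_mem_cons.2 ⟨hD, fun E hE => (hΓ E hE).mono hpq⟩
  have shift : ∀ {Γ : List (IFormula L')} {p : World L n A} {σ : ℕ → L'.Term ℕ} (t : L'.Term ℕ),
      (∀ D ∈ Γ, Forces φ f p σ D) →
      ∀ D ∈ Γ.map IFormula.shift, Forces φ f p (envCons t σ) D := fun t hΓ =>
    List.forall_mem_map.2 fun D hD => forces_shift.2 (hΓ D hD)
  induction h generalizing p σ with
  | ax h => exact hΓ _ h
  | botE _ ih => exact .of_cover_false (ih hΓ)
  | impI _ ih => exact fun q hq hC => ih (cons hΓ hq hC)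
  | impE _ _ ih₁ ih₂ => exact ih₁ hΓ p le_rfl (ih₂ hΓ)
  | andI _ _ ih₁ ih₂ => exact ⟨ih₁ hΓ, ih₂ hΓ⟩
  | andE₁ _ ih => exact (ih hΓ).1
  | andE₂ _ ih => exact (ih hΓ).2
  | orI₁ _ ih => exact World.Cover.of_forall fun q hq => .inl ((ih hΓ).mono hq)
  | orI₂ _ ih => exact World.Cover.of_forall fun q hq => .inr ((ih hΓ).mono hq)
  | orE _ _ _ ih ih₁ ih₂ =>
    refine .of_cover (World.Cover.map (ih hΓ) fun q hq h => ?_)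
    rcases h with h | h
    · exact ih₁ (cons hΓ hq h)
    · exact ih₂ (cons hΓ hq h)
  | allI _ ih => exact fun t => ih (shift t hΓ)
  | allE t _ ih => exact forces_inst.2 (ih hΓ _)
  | exI t _ ih =>
    exact World.Cover.of_forall fun q hq => ⟨_, forces_inst.1 ((ih hΓ).mono hq)⟩
  | exE _ _ ih₁ ih₂ =>
    refine .of_cover (World.Cover.map (ih₁ hΓ) fun q hq h => ?_)
    obtain ⟨t, ht⟩ := h
    exact forces_shift.1 (ih₂ (cons (shift t hΓ) hq ht))

/-- For formulas without the Skolem symbol, forcing is provability. -/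
theorem forces_iff_provable (hφ : φ.Injective)
    (hf : ∀ k (g : L'.Functions k), (⟨k, g⟩ : Σ m, L'.Functions m) ≠ ⟨n, f⟩ →
      ∃ h, φ.onFunction h = g)
    {C : IFormula L} (hC : ¬ (C.mapLang φ).Occurs f) {p : World L n A} {σ : ℕ → L'.Term ℕ}
    {s : ℕ → L.Term ℕ} (hs : ∀ k, Eval φ f p.val (σ k) (s k)) :
    Forces φ f p σ (C.mapLang φ) ↔ Provable p.ctx (C.subst s) := by
  have mono : ∀ {p q : World L n A} {σ : ℕ → L'.Term ℕ} {s : ℕ → L.Term ℕ}, p ≤ q →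
      (∀ k, Eval φ f p.val (σ k) (s k)) → ∀ k, Eval φ f q.val (σ k) (s k) :=
    fun h hs k => (hs k).mono h.2
  induction C generalizing p σ s with
  | rel R ts =>
    have ev : ∀ {q}, p ≤ q → ∀ i,
        Eval φ f q.val ((φ.onTerm (ts i)).subst σ) ((ts i).subst s) := fun hq i =>
      eval_onTerm_subst (mono hq hs) fun h => hC ⟨i, h⟩
    constructor
    · refine fun h => h _ p le_rfl ?_
      rintro q hq ⟨S, us, hS, hus, h⟩
      obtain rfl := hφ.onRelation hS
      obtain rfl : us = fun i => (ts i).subst s :=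
        funext fun i => (hus i).unique hφ q.functional (ev hq i)
      exact h
    · exact fun h => World.Cover.of_forall fun q hq => ⟨R, _, rfl, ev hq, h.weaken hq.1⟩
  | bot =>
    exact ⟨fun h => h _ p le_rfl fun _ _ h => h.elim, fun h Z q hq _ => .botE (h.weaken hq.1)⟩
  | imp C D ihC ihD =>
    simp only [IFormula.mapLang, IFormula.Occurs, not_or] at hC
    constructor
    · intro h
      have hle := p.le_addHyp (C.subst s)
      exact .impI ((ihD hC.2 (mono hle hs)).1
        (h _ hle ((ihC hC.1 (mono hle hs)).2 (.ax List.mem_cons_self))))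
    · exact fun h q hq hCq => (ihD hC.2 (mono hq hs)).2
        (.impE (h.weaken hq.1) ((ihC hC.1 (mono hq hs)).1 hCq))
  | and C D ihC ihD =>
    simp only [IFormula.mapLang, IFormula.Occurs, not_or] at hC
    exact ⟨fun h => .andI ((ihC hC.1 hs).1 h.1) ((ihD hC.2 hs).1 h.2),
      fun h => ⟨(ihC hC.1 hs).2 (.andE₁ h), (ihD hC.2 hs).2 (.andE₂ h)⟩⟩
  | or C D ihC ihD =>
    simp only [IFormula.mapLang, IFormula.Occurs, not_or] at hC
    constructor
    · refine fun h => h _ p le_rfl ?_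
      rintro q hq (h | h)
      · exact .orI₁ ((ihC hC.1 (mono hq hs)).1 h)
      · exact .orI₂ ((ihD hC.2 (mono hq hs)).1 h)
    · intro h Z q hq hZ
      have hleC := q.le_addHyp (C.subst s)
      have hleD := q.le_addHyp (D.subst s)
      exact .orE (h.weaken hq.1)
        (hZ _ hleC (.inl ((ihC hC.1 (mono (hq.trans hleC) hs)).2 (.ax List.mem_cons_self))))
        (hZ _ hleD (.inr ((ihD hC.2 (mono (hq.trans hleD) hs)).2 (.ax List.mem_cons_self))))
  | all C ih =>
    constructor
    · intro h
      obtain ⟨c, hc⟩ := Provable.exists_allI p.ctx (C.subst (liftSubst s))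
      refine hc ?_
      rw [subst_liftSubst_inst]
      exact (ih hC (eval_envCons (t := Term.var c) rfl hs)).1 (h _)
    -- The individual `t` may have no value at `p`, but it has one on a cover.
    · refine fun h t => .of_cover ((p.cover_eval hf t).map ?_)
      rintro q hq ⟨a, ha⟩
      refine (ih hC (eval_envCons ha (mono hq hs))).2 ?_
      rw [← subst_liftSubst_inst]
      exact .allE _ (h.weaken hq.1)
  | ex C ih =>
    constructor
    · refine fun h => h _ p le_rfl ?_
      rintro q hq ⟨t, ht⟩
      refine q.cover_eval hf t _ q le_rfl ?_
      rintro r hr ⟨a, ha⟩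
      refine .exI a ?_
      rw [subst_liftSubst_inst]
      exact (ih hC (eval_envCons ha (mono (hq.trans hr) hs))).1 (ht.mono hr)
    · intro h Z q hq hZ
      obtain ⟨c, hc⟩ := Provable.exists_exE q.ctx (C.subst (liftSubst s)) Z
      refine hc (h.weaken hq.1) ?_
      rw [subst_liftSubst_inst]
      have hle := q.le_addHyp (C.subst (envCons (Term.var c) s))
      exact hZ _ hle ⟨Term.var c,
        (ih hC (eval_envCons (t := Term.var c) rfl (mono (hq.trans hle) hs))).2
          (.ax List.mem_cons_self)⟩

theorem forces_skolemAxiom (hφ : φ.Injective)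
    (hf : ∀ k (g : L'.Functions k), (⟨k, g⟩ : Σ m, L'.Functions m) ≠ ⟨n, f⟩ →
      ∃ h, φ.onFunction h = g)
    (hA : ¬ (A.mapLang φ).Occurs f) (p : World L n A) :
    Forces φ f p Term.var (skolemAxiom f (A.mapLang φ)) := by
  refine forces_allN.2 fun ts => forces_inst.2 ?_
  have hterm : (skolemTerm f).subst (envConsN ts Term.var) = Term.func f ts := by
    simp only [skolemTerm, Term.subst, envConsN, Fin.is_lt, dif_pos, Fin.eta, Fin.rev_rev]
  rw [hterm]
  refine .of_cover ((p.cover_eval hf (Term.func f ts)).map ?_)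
  rintro q - ⟨e, he⟩
  obtain ⟨us, hus, hmem⟩ := eval_skolem_iff.1 he
  exact (forces_iff_provable hφ hf hA
    (eval_envCons he (eval_envConsN hus (σ := Term.var) (s := Term.var) fun _ => rfl))).2
    (q.sound us e hmem)

/-- Elimination of the Skolem axiom, for a language `L'` whose symbols other than `f` come from `L`
(where `f` itself may or may not come from `L`). -/
theorem provable_of_provable_skolemAxiom (hφ : φ.Injective)
    (hf : ∀ k (g : L'.Functions k), (⟨k, g⟩ : Σ m, L'.Functions m) ≠ ⟨n, f⟩ →
      ∃ h, φ.onFunction h = g)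
    {Γ : List (IFormula L)} {B : IFormula L} (hA : ¬ (A.mapLang φ).Occurs f)
    (hΓ : ∀ C ∈ Γ, ¬ (C.mapLang φ).Occurs f) (hB : ¬ (B.mapLang φ).Occurs f)
    (htotal : Provable Γ (forallExists n A))
    (h : Provable (skolemAxiom f (A.mapLang φ) :: Γ.map (·.mapLang φ)) (B.mapLang φ)) :
    Provable Γ B := by
  let p : World L n A := ⟨Γ, ∅, htotal, fun _ _ _ h => h.elim, fun _ _ h => h.elim⟩
  have iff : ∀ {C : IFormula L}, ¬ (C.mapLang φ).Occurs f →
      (Forces φ f p Term.var (C.mapLang φ) ↔ Provable Γ C) := fun {C} hC => by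
    have := forces_iff_provable (p := p) (σ := Term.var) (s := Term.var) hφ hf hC fun _ => rfl
    rwa [subst_var] at this
  refine (iff hB).1 (forces_of_provable h (List.forall_mem_cons.2
    ⟨forces_skolemAxiom hφ hf hA p, List.forall_mem_map.2 fun C hC => ?_⟩))
  exact (iff (hΓ C hC)).2 (.ax hC)

end Forcing

/-! ### Extension by a new function symbol -/

section Extension

variable {L : FirstOrder.Language.{u, v}} {n : ℕ}

theorem not_occursInTerm_newFunction (t : L.Term ℕ) :
    ¬ OccursInTerm (newFunction L n) ((inclusion L n).onTerm t) := by
  induction t with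
  | var k => exact id
  | func g ts ih =>
    rintro (h | ⟨i, hi⟩)
    · cases h
    · exact ih i hi

theorem not_occurs_newFunction (A : IFormula L) :
    ¬ (A.mapLang (inclusion L n)).Occurs (newFunction L n) := by
  induction A with
  | rel R ts =>
    rintro ⟨i, hi⟩
    exact not_occursInTerm_newFunction _ hi
  | bot => exact id
  | imp A B ihA ihB => exact not_or.2 ⟨ihA, ihB⟩
  | and A B ihA ihB => exact not_or.2 ⟨ihA, ihB⟩
  | or A B ihA ihB => exact not_or.2 ⟨ihA, ihB⟩
  | all A ih => exact ih
  | ex A ih => exact ih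

theorem exists_inclusion_of_ne_newFunction (k : ℕ) (g : (withFunction L n).Functions k)
    (hg : (⟨k, g⟩ : Σ m, (withFunction L n).Functions m) ≠ ⟨n, newFunction L n⟩) :
    ∃ h, (inclusion L n).onFunction h = g := by
  rcases g with g | g
  · exact ⟨g, rfl⟩
  · cases g
    exact (hg rfl).elim

/-- Finitely many axioms of a theory extended by one formula are, up to weakening, that formula and
finitely many axioms of the theory. -/
theorem exists_subset_cons_map {α β : Type*} (m : α → β) (T : Set α) (b : β) (Δ : List β)
    (h : ∀ C ∈ Δ, C ∈ insert b (m '' T)) :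
    ∃ Γ : List α, (∀ C ∈ Γ, C ∈ T) ∧ Δ ⊆ b :: Γ.map m := by
  induction Δ with
  | nil => exact ⟨[], by simp, by simp⟩
  | cons C Δ ih =>
    obtain ⟨hC, hΔ⟩ := List.forall_mem_cons.1 h
    obtain ⟨Γ, hΓ, hsub⟩ := ih hΔ
    rcases hC with rfl | ⟨D, hD, rfl⟩
    · exact ⟨Γ, hΓ, List.cons_subset.2 ⟨List.mem_cons_self, hsub⟩⟩
    · refine ⟨D :: Γ, List.forall_mem_cons.2 ⟨hD, hΓ⟩, List.cons_subset.2 ⟨by simp, ?_⟩⟩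
      exact List.Subset.trans hsub (List.cons_subset_cons _ (List.subset_cons_self _ _))

end Extension

end IntLogic

theorem mainTheorem1 (L : FirstOrder.Language.{u, v}) (n : ℕ) :
    (∀ (f : L.Functions n) (A : IFormula L) (Γ : List (IFormula L)) (B : IFormula L),
      (∀ k, A.FreeIn k → k ≤ n) → ¬ A.Occurs f → (∀ C ∈ Γ, ¬ C.Occurs f) → ¬ B.Occurs f →
      Provable Γ (forallExists n A) → Provable (skolemAxiom f A :: Γ) B →
      Provable Γ B) ∧
    (∀ (A : IFormula L) (T : Set (IFormula L)),
      (∀ k, A.FreeIn k → k ≤ n) → TheoremOf T (forallExists n A) →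
      IsConservativeExtension (inclusion L n) T
        (insert (skolemAxiom (newFunction L n) (A.mapLang (inclusion L n)))
          (IFormula.mapLang (inclusion L n) '' T))) := by
  constructor
  · intro f A Γ B _ hA hΓ hB htotal h
    refine provable_of_provable_skolemAxiom (φ := FirstOrder.Language.LHom.id L) (f := f) (A := A)
      ⟨fun h => h, fun h => h⟩ (fun _ g _ => ⟨g, rfl⟩) ?_ ?_ ?_ htotal ?_
    · rwa [mapLang_id]
    · simpa only [mapLang_id] using hΓ
    · rwa [mapLang_id]
    · simpa only [mapLang_id, List.map_id'] using h
  · rintro A T _ ⟨Γ₀, hΓ₀, htotal⟩ B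
    constructor
    · rintro ⟨Δ, hΔ, h⟩
      obtain ⟨Γ, hΓ, hsub⟩ := exists_subset_cons_map _ T _ Δ hΔ
      refine ⟨Γ₀ ++ Γ, fun C hC => (List.mem_append.1 hC).elim (hΓ₀ C) (hΓ C), ?_⟩
      refine provable_of_provable_skolemAxiom (φ := inclusion L n) (f := newFunction L n)
        FirstOrder.Language.LHom.sumInl_injective exists_inclusion_of_ne_newFunction
        (not_occurs_newFunction A) (fun C _ => not_occurs_newFunction C) (not_occurs_newFunction B)
        (htotal.weaken (List.subset_append_left _ _)) (h.weaken (List.Subset.trans hsub ?_))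
      exact List.cons_subset_cons _ (List.map_subset _ (List.subset_append_right _ _))
    · rintro ⟨Γ, hΓ, h⟩
      exact ⟨Γ.map (·.mapLang (inclusion L n)),
        List.forall_mem_map.2 fun C hC => .inr ⟨C, hΓ C hC, rfl⟩, h.mapLang _⟩
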